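/- Let $q$ be a prime power. For nonnegative integers $v,d,k$ let $A_q(v,d;k)$ denote the maximum cardinality of a set of $k$-dimensional linear subspaces of $\mathbb{F}_q^v$ such that any two distinct members $U,W$ of the set satisfy $\dim(U+W)-\dim(U\cap W)\ge d$. (For $d=4$, $k=3$ this says that any two distinct members intersect in a subspace of dimension at most $1$.) Then for all integers $t\ge 0$, $$A_q(6+3t,4;3)\ \ge\ \left(q^6+2q^2+2q+1\right)q^{6t}+\frac{q^{6t}-1}{q^6-1}+\sum_{i=1}^{t}\left(2q^2+2q\right)\left(q^3-1\right)^i q^{6(t-i)}.$$ -/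

import Mathlib

/-- The subspace distance `dim (U + W) - dim (U ∩ W)`. The subtraction of natural numbers never
truncates (for finite-dimensional ambient spaces), since `U ⊓ W ≤ U ⊔ W`. -/
noncomputable def subspaceDist {F V : Type*} [Field F] [AddCommGroup V] [Module F V]
    (U W : Submodule F V) : ℕ :=
  Module.finrank F ↥(U ⊔ W) - Module.finrank F ↥(U ⊓ W)

/-- A set of `k`-dimensional subspaces of `V` whose distinct elements pairwise have subspace
distance at least `d`. -/
structure IsConstantDimensionCode {F V : Type*} [Field F] [AddCommGroup V] [Module F V]
    (d k : ℕ) (C : Set (Submodule F V)) : Prop where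
  finrank_eq : ∀ U ∈ C, Module.finrank F ↥U = k
  le_subspaceDist : ∀ U ∈ C, ∀ W ∈ C, U ≠ W → d ≤ subspaceDist U W

/-- `A_q(v,d;k)`, where `F` is the field with `q` elements: the maximum cardinality of a set of
`k`-dimensional subspaces of `F^v` with pairwise subspace distance at least `d`. -/
noncomputable def maxCodeSize (F : Type*) [Field F] (v d k : ℕ) : ℕ :=
  sSup {n : ℕ | ∃ C : Set (Submodule F (Fin v → F)), IsConstantDimensionCode d k C ∧ C.ncard = n}

/-- Over a finite field the supremum in the definition of `maxCodeSize` is attained. -/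
theorem maxCodeSize_isGreatest (F : Type*) [Field F] [Finite F] (v d k : ℕ) :
    IsGreatest {n : ℕ | ∃ C : Set (Submodule F (Fin v → F)),
      IsConstantDimensionCode d k C ∧ C.ncard = n} (maxCodeSize F v d k) := by
  have : Finite (Submodule F (Fin v → F)) :=
    Finite.of_injective (fun U : Submodule F (Fin v → F) => (U : Set (Fin v → F)))
      SetLike.coe_injective
  have hb : BddAbove {n : ℕ | ∃ C : Set (Submodule F (Fin v → F)),
      IsConstantDimensionCode d k C ∧ C.ncard = n} := by
    refine ⟨Nat.card (Submodule F (Fin v → F)), ?_⟩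
    rintro n ⟨C, -, rfl⟩
    rw [← Set.ncard_univ]
    exact Set.ncard_le_ncard (Set.subset_univ C)
  refine ⟨Nat.sSup_mem ⟨0, ∅, ⟨by simp, by simp⟩, by simp⟩ hb, fun n hn => le_csSup hb hn⟩

/-! The bound comes from a good code in dimension 6 and a linkage step that raises the dimension by
3. Let `K` be the cubic extension of `F` with Frobenius `σ`, and work in `K × K`. The graphs of all
`a σ + b σ²` form a code `G` of q^6 planes disjoint from `S = 0 × K`. For the quadratic form Tr(xy),
such a graph carries the form Tr((a + σ b) z σ(z)), which vanishes on no 2-dimensional subspace if a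
+ σ b ≠ 0. Discarding the q^3 graphs with a + σ b = 0 makes room for two kinds of totally singular
planes (`crossPlane`, `pointPlane`) and for `linePlane`. The result is a code of size q^6 + 2q^2 +
2q + 1 (`isPlaneFamily_codePlane`). Linkage (`HasPlaneCode.linkage`): given a code in `V`, put a
copy of `G` into `U × K` for each member `U`, with `S` placed on `0 × K`. Over a family of pairwise
disjoint `U` the larger code can be used instead, with one member `W` placed on `0 × K`; the plane
`0 × K` itself is added once. To iterate, the new code must again contain disjoint families. This is
why two of them are carried along: `D` is spent on the larger code, while over `E` the copies of `G`
supply both new families, from the graphs of `a σ` and of `b σ²`. -/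

/-- Two subspaces meet in a subspace of dimension at most one. -/
def MeetInPoint {F V : Type*} [Field F] [AddCommGroup V] [Module F V]
    (X Y : Submodule F V) : Prop :=
  Module.finrank F ↥(X ⊓ Y) ≤ 1

namespace MeetInPoint

variable {F V M : Type*} [Field F] [AddCommGroup V] [Module F V] [AddCommGroup M] [Module F M]

theorem symm {X Y : Submodule F V} (h : MeetInPoint X Y) : MeetInPoint Y X := by
  unfold MeetInPoint at *
  rwa [inf_comm]

theorem of_forall {X Y : Submodule F V}
    (h : ∀ v ∈ X, v ∈ Y → ∀ w ∈ X, w ∈ Y → v ≠ 0 → ∃ c : F, w = c • v) : MeetInPoint X Y := by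
  by_cases hb : X ⊓ Y = ⊥
  · unfold MeetInPoint
    rw [hb]
    simp
  · obtain ⟨v, hv, hv0⟩ := Submodule.exists_mem_ne_zero_of_ne_bot hb
    refine finrank_le_one ⟨v, hv⟩ fun w => ?_
    obtain ⟨c, hc⟩ := h v hv.1 hv.2 w w.2.1 w.2.2 hv0
    exact ⟨c, Subtype.ext hc.symm⟩

theorem of_disjoint {X Y : Submodule F V} (h : Disjoint X Y) : MeetInPoint X Y := by
  unfold MeetInPoint
  rw [h.eq_bot]
  simp

theorem mono [FiniteDimensional F V] {X Y X' Y' : Submodule F V} (h : MeetInPoint X' Y')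
    (hX : X ⊓ Y ≤ X' ⊓ Y') : MeetInPoint X Y :=
  (Submodule.finrank_mono hX).trans h

theorem map {X Y : Submodule F M} (h : MeetInPoint X Y) {φ : M →ₗ[F] V}
    (hφ : Function.Injective φ) : MeetInPoint (X.map φ) (Y.map φ) := by
  unfold MeetInPoint at *
  rwa [← Submodule.map_inf φ hφ, ← (Submodule.equivMapOfInjective φ hφ (X ⊓ Y)).finrank_eq]

/-- If `φ` is injective on `X` and maps `X ⊓ Y` into `Z`, with `Z` of dimension at most one. -/
theorem of_map_le [FiniteDimensional F M] {X Y : Submodule F V} {Z : Submodule F M} (φ : V →ₗ[F] M)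
    (hφ : ∀ v ∈ X, φ v = 0 → v = 0) (hZ : Module.finrank F Z ≤ 1)
    (h : ∀ v ∈ X, v ∈ Y → φ v ∈ Z) : MeetInPoint X Y := by
  refine le_trans ?_ hZ
  refine LinearMap.finrank_le_finrank_of_injective
    (f := (φ.restrict (p := X ⊓ Y) (q := Z) fun v hv => h v hv.1 hv.2)) ?_
  rw [injective_iff_map_eq_zero]
  intro v hv
  exact Subtype.ext (hφ v v.2.1 (congrArg Subtype.val hv))

end MeetInPoint

/-- A finite set of planes that pairwise meet in at most a projective point. -/
structure IsPlaneCode {F V : Type*} [Field F] [AddCommGroup V] [Module F V]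
    (C : Finset (Submodule F V)) : Prop where
  finrank_eq : ∀ X ∈ C, Module.finrank F X = 3
  meetInPoint : ∀ X ∈ C, ∀ Y ∈ C, X ≠ Y → MeetInPoint X Y

/-- There is a plane code with `N` elements that contains two disjoint families of `r`
pairwise disjoint planes. -/
def HasPlaneCode (F V : Type*) [Field F] [AddCommGroup V] [Module F V] (N r : ℕ) : Prop :=
  ∃ C D E : Finset (Submodule F V), IsPlaneCode C ∧ D ⊆ C ∧ E ⊆ C ∧ Disjoint D E ∧
    (D : Set (Submodule F V)).Pairwise Disjoint ∧ (E : Set (Submodule F V)).Pairwise Disjoint ∧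
    C.card = N ∧ D.card = r ∧ E.card = r

/-! ### Transport of codes along injective linear maps. -/

section Transport

variable {F V M : Type*} [Field F] [AddCommGroup V] [Module F V] [AddCommGroup M] [Module F M]

theorem finrank_map_of_injective {φ : M →ₗ[F] V} (hφ : Function.Injective φ)
    (X : Submodule F M) : Module.finrank F (X.map φ) = Module.finrank F X :=
  (Submodule.equivMapOfInjective φ hφ X).finrank_eq.symm

open Classical in
theorem IsPlaneCode.image {C : Finset (Submodule F M)} (hC : IsPlaneCode C) {φ : M →ₗ[F] V}
    (hφ : Function.Injective φ) : IsPlaneCode (C.image (Submodule.map φ)) := by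
  constructor
  · intro X hX
    obtain ⟨X₀, hX₀, rfl⟩ := Finset.mem_image.1 hX
    rw [finrank_map_of_injective hφ, hC.finrank_eq X₀ hX₀]
  · intro X hX Y hY hXY
    obtain ⟨X₀, hX₀, rfl⟩ := Finset.mem_image.1 hX
    obtain ⟨Y₀, hY₀, rfl⟩ := Finset.mem_image.1 hY
    exact (hC.meetInPoint X₀ hX₀ Y₀ hY₀ fun h => hXY (by rw [h])).map hφ

open Classical in
theorem pairwise_disjoint_image {D : Finset (Submodule F M)}
    (hD : (D : Set (Submodule F M)).Pairwise Disjoint) {φ : M →ₗ[F] V}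
    (hφ : Function.Injective φ) :
    ((D.image (Submodule.map φ) : Finset _) : Set (Submodule F V)).Pairwise Disjoint := by
  intro X hX Y hY hXY
  obtain ⟨X₀, hX₀, rfl⟩ := Finset.mem_image.1 (Finset.mem_coe.1 hX)
  obtain ⟨Y₀, hY₀, rfl⟩ := Finset.mem_image.1 (Finset.mem_coe.1 hY)
  have h := (hD hX₀ hY₀ fun h => hXY (by rw [h])).eq_bot
  rw [disjoint_iff, ← Submodule.map_inf φ hφ, h, Submodule.map_bot]

open Classical in
theorem HasPlaneCode.map {N r : ℕ} (h : HasPlaneCode F M N r) (e : M ≃ₗ[F] V) :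
    HasPlaneCode F V N r := by
  obtain ⟨C, D, E, hC, hDC, hEC, hDE, hD, hE, hCc, hDc, hEc⟩ := h
  have hi : Function.Injective (Submodule.map (e : M →ₗ[F] V)) :=
    Submodule.map_injective_of_injective e.injective
  refine ⟨_, _, _, hC.image (φ := (e : M →ₗ[F] V)) e.injective, Finset.image_subset_image hDC,
    Finset.image_subset_image hEC, (Finset.disjoint_image hi).2 hDE,
    pairwise_disjoint_image hD e.injective, pairwise_disjoint_image hE e.injective, ?_, ?_, ?_⟩
  all_goals rwa [Finset.card_image_of_injective _ hi]

end Transport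

/-! ### The linkage construction. -/

section Linkage

variable {F V K M : Type*} [Field F] [AddCommGroup V] [Module F V] [AddCommGroup K] [Module F K]
  [AddCommGroup M] [Module F M]

/-- A plane `S` of a `6`-dimensional space `M` can be carried to `0 × K` by an embedding of `M`
onto `U × K`. -/
theorem exists_embedding [FiniteDimensional F M] [FiniteDimensional F V] [FiniteDimensional F K]
    (hM : Module.finrank F M = 6) (hK : Module.finrank F K = 3)
    {S : Submodule F M} (hS : Module.finrank F S = 3)
    {U : Submodule F V} (hU : Module.finrank F U = 3) :
    ∃ φ : M →ₗ[F] V × K, Function.Injective φ ∧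
      S.map φ = (⊥ : Submodule F V).prod ⊤ ∧ LinearMap.range φ ≤ U.prod ⊤ := by
  obtain ⟨S', hS'⟩ := S.exists_isCompl
  have h6 := Submodule.finrank_add_eq_of_isCompl hS'
  have e₀ : S ≃ₗ[F] K := LinearEquiv.ofFinrankEq _ _ (by omega)
  have e₁ : S' ≃ₗ[F] U := LinearEquiv.ofFinrankEq _ _ (by omega)
  let e : M ≃ₗ[F] S × S' := (Submodule.prodEquivOfIsCompl S S' hS').symm
  let φ : M →ₗ[F] V × K :=
    (U.subtype ∘ₗ e₁.toLinearMap ∘ₗ LinearMap.snd F S S' ∘ₗ e.toLinearMap).prod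
      (e₀.toLinearMap ∘ₗ LinearMap.fst F S S' ∘ₗ e.toLinearMap)
  have hφ : ∀ m, φ m = ((e₁ (e m).2 : V), e₀ (e m).1) := fun m => rfl
  refine ⟨φ, ?_, ?_, ?_⟩
  · rw [injective_iff_map_eq_zero]
    intro m hm
    rw [hφ, Prod.mk_eq_zero] at hm
    have h1 : (e m).1 = 0 := by simpa using hm.2
    have h2 : (e m).2 = 0 := by simpa using hm.1
    exact e.map_eq_zero_iff.1 (Prod.ext h1 h2)
  · ext ⟨v, k⟩
    simp only [Submodule.mem_map, Submodule.mem_prod, Submodule.mem_bot, Submodule.mem_top,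
      and_true]
    constructor
    · rintro ⟨m, hm, h⟩
      rw [hφ, Prod.mk.injEq] at h
      have h2 : (e m).2 = 0 := (Submodule.prodEquivOfIsCompl_symm_apply_snd_eq_zero _ _ hS').2 hm
      rw [← h.1, h2]
      simp
    · rintro rfl
      refine ⟨e.symm (e₀.symm k, 0), ?_, ?_⟩
      · simp [e]
      · simp [hφ]
  · rintro _ ⟨m, rfl⟩
    rw [hφ]
    simp

/-- The data in a `6`-dimensional space used to enlarge codes: a code `G` of planes disjoint from
the plane `S`, a code `C` with a member `W`, and two disjoint families of `r` pairwise disjoint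
planes in `C ∩ G`. -/
structure IsLinkageData (S W : Submodule F M) (G C D E : Finset (Submodule F M)) (r : ℕ) :
    Prop where
  finrank_S : Module.finrank F S = 3
  isPlaneCode_G : IsPlaneCode G
  disjoint_S : ∀ X ∈ G, Disjoint X S
  isPlaneCode_C : IsPlaneCode C
  W_mem : W ∈ C
  D_subset_G : D ⊆ G
  E_subset_G : E ⊆ G
  D_subset_C : D ⊆ C
  E_subset_C : E ⊆ C
  disjoint_D_E : Disjoint D E
  pairwise_D : (D : Set (Submodule F M)).Pairwise Disjoint
  pairwise_E : (E : Set (Submodule F M)).Pairwise Disjoint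
  card_D : D.card = r
  card_E : E.card = r

/-- The projection to `V` has kernel `0 × K`, so it is injective on `X`, and it sends the
intersection into `U ⊓ U'`. -/
theorem meetInPoint_of_le_prod [FiniteDimensional F V] [FiniteDimensional F K]
    {U U' : Submodule F V} {X Y : Submodule F (V × K)} (hU : MeetInPoint U U')
    (hX : X ≤ U.prod ⊤) (hY : Y ≤ U'.prod ⊤) (hd : Disjoint X ((⊥ : Submodule F V).prod ⊤)) :
    MeetInPoint X Y := by
  refine MeetInPoint.of_map_le (LinearMap.fst F V K) ?_ hU ?_
  · intro v hv h0
    exact (Submodule.disjoint_def.1 hd) v hv ⟨h0, trivial⟩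
  · intro v hv hv'
    exact ⟨(hX hv).1, (hY hv').1⟩

/-- A plane meets itself in dimension 3. Thus `MeetInPoint` also yields distinctness, on which the
cardinality counts rest. -/
theorem ne_of_meetInPoint {X Y : Submodule F V} (hX : Module.finrank F X = 3)
    (h : MeetInPoint X Y) : X ≠ Y := by
  rintro rfl
  unfold MeetInPoint at h
  rw [inf_idem] at h
  omega

open Classical in
/-- Planes that are lifted over a family of pairwise disjoint planes. -/
theorem pairwise_disjoint_biUnion_image [FiniteDimensional F V]
    {E : Finset (Submodule F V)} (hE : (E : Set (Submodule F V)).Pairwise Disjoint)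
    {φ : Submodule F V → M →ₗ[F] V × K} (hφ : ∀ U ∈ E, Function.Injective (φ U))
    (hr : ∀ U ∈ E, LinearMap.range (φ U) ≤ U.prod ⊤)
    {D : Finset (Submodule F M)} (hD : (D : Set (Submodule F M)).Pairwise Disjoint)
    (hS : ∀ U ∈ E, ∀ X ∈ D, Disjoint (X.map (φ U)) ((⊥ : Submodule F V).prod ⊤)) :
    ((E.biUnion fun U => D.image (Submodule.map (φ U)) : Finset _) :
      Set (Submodule F (V × K))).Pairwise Disjoint := by
  intro X hX Y hY hXY
  obtain ⟨U, hU, hX⟩ := Finset.mem_biUnion.1 (Finset.mem_coe.1 hX)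
  obtain ⟨U', hU', hY⟩ := Finset.mem_biUnion.1 (Finset.mem_coe.1 hY)
  by_cases hUU : U = U'
  · subst hUU
    exact pairwise_disjoint_image hD (hφ U hU) hX hY hXY
  · obtain ⟨X, hX', rfl⟩ := Finset.mem_image.1 hX
    obtain ⟨Y, hY', rfl⟩ := Finset.mem_image.1 hY
    have hd := hE hU hU' hUU
    rw [Submodule.disjoint_def] at hd ⊢
    intro v hv hv'
    refine Submodule.disjoint_def.1 (hS U hU X hX') v hv ⟨?_, trivial⟩
    exact hd _ (hr U hU (LinearMap.map_le_range hv)).1 (hr U' hU' (LinearMap.map_le_range hv')).1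

open Classical in
-- `m` is the gain of `C₀` over `G` once `W` is removed. Each of the `s` members of `D` contributes
-- this gain, and the final `+ 1` counts the common image `0 × K`.
theorem HasPlaneCode.linkage [FiniteDimensional F M] [FiniteDimensional F V]
    [FiniteDimensional F K] (hM : Module.finrank F M = 6) (hK : Module.finrank F K = 3)
    {S W : Submodule F M} {G C₀ D₀ E₀ : Finset (Submodule F M)} {r : ℕ}
    (L : IsLinkageData S W G C₀ D₀ E₀ r) {m N s : ℕ} (hm : C₀.card = G.card + m + 1)
    (h : HasPlaneCode F V N s) : HasPlaneCode F (V × K) (N * G.card + s * m + 1) (s * r) := by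
  obtain ⟨C, D, E, hC, hDC, hEC, hDE, hD, hE, hCc, hDc, hEc⟩ := h
  set W' : Submodule F (V × K) := (⊥ : Submodule F V).prod ⊤ with hW'
  have hφ : ∀ U : Submodule F V, ∃ φ : M →ₗ[F] V × K, U ∈ C → Function.Injective φ ∧
      S.map φ = W' ∧ LinearMap.range φ ≤ U.prod ⊤ := by
    intro U
    by_cases hU : U ∈ C
    · obtain ⟨φ, hφ⟩ := exists_embedding hM hK L.finrank_S (hC.finrank_eq U hU)
      exact ⟨φ, fun _ => hφ⟩
    -- Outside `C` the zero map is a dummy value that makes the choice total.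
    · exact ⟨0, fun h => absurd h hU⟩
  have hψ : ∀ U : Submodule F V, ∃ φ : M →ₗ[F] V × K, U ∈ C → Function.Injective φ ∧
      W.map φ = W' ∧ LinearMap.range φ ≤ U.prod ⊤ := by
    intro U
    by_cases hU : U ∈ C
    · obtain ⟨φ, hφ⟩ := exists_embedding hM hK (L.isPlaneCode_C.finrank_eq W L.W_mem)
        (hC.finrank_eq U hU)
      exact ⟨φ, fun _ => hφ⟩
    · exact ⟨0, fun h => absurd h hU⟩
  choose φ hφ using hφ
  choose ψ hψ using hψ
  have hGd : ∀ U ∈ C, ∀ X ∈ G, Disjoint (X.map (φ U)) W' := by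
    intro U hU X hX
    obtain ⟨hi, hS, -⟩ := hφ U hU
    rw [← hS, disjoint_iff, ← Submodule.map_inf _ hi, (L.disjoint_S X hX).eq_bot,
      Submodule.map_bot]
  have hCe : IsPlaneCode (C₀.erase W) :=
    ⟨fun X hX => L.isPlaneCode_C.finrank_eq X (Finset.mem_of_mem_erase hX),
      fun X hX Y hY => L.isPlaneCode_C.meetInPoint X (Finset.mem_of_mem_erase hX) Y
        (Finset.mem_of_mem_erase hY)⟩
  let fam : Submodule F V → Finset (Submodule F (V × K)) := fun U =>
    if U ∈ D then (C₀.erase W).image (Submodule.map (ψ U)) else G.image (Submodule.map (φ U))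
  have fam_pos : ∀ U ∈ D, fam U = (C₀.erase W).image (Submodule.map (ψ U)) :=
    fun U hU => if_pos hU
  have fam_neg : ∀ U ∉ D, fam U = G.image (Submodule.map (φ U)) := fun U hU => if_neg hU
  have fam_code : ∀ U ∈ C, IsPlaneCode (fam U) := by
    intro U hU
    by_cases hUD : U ∈ D
    · rw [fam_pos U hUD]
      exact hCe.image (hψ U hU).1
    · rw [fam_neg U hUD]
      exact L.isPlaneCode_G.image (hφ U hU).1
  have fam_le : ∀ U ∈ C, ∀ X ∈ fam U, X ≤ U.prod ⊤ := by
    intro U hU X hX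
    by_cases hUD : U ∈ D
    · rw [fam_pos U hUD] at hX
      obtain ⟨X, hX, rfl⟩ := Finset.mem_image.1 hX
      exact LinearMap.map_le_range.trans (hψ U hU).2.2
    · rw [fam_neg U hUD] at hX
      obtain ⟨X, hX, rfl⟩ := Finset.mem_image.1 hX
      exact LinearMap.map_le_range.trans (hφ U hU).2.2
  have fam_disj : ∀ U ∈ C, U ∉ D → ∀ X ∈ fam U, Disjoint X W' := by
    intro U hU hUD X hX
    rw [fam_neg U hUD] at hX
    obtain ⟨X₀, hX₀, rfl⟩ := Finset.mem_image.1 hX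
    exact hGd U hU X₀ hX₀
  have fam_W : ∀ U ∈ C, ∀ X ∈ fam U, MeetInPoint X W' := by
    intro U hU X hX
    by_cases hUD : U ∈ D
    · rw [fam_pos U hUD] at hX
      obtain ⟨X₀, hX₀, rfl⟩ := Finset.mem_image.1 hX
      rw [← (hψ U hU).2.1]
      exact (L.isPlaneCode_C.meetInPoint X₀ (Finset.mem_of_mem_erase hX₀) W L.W_mem
        (Finset.ne_of_mem_erase hX₀)).map (hψ U hU).1
    · exact .of_disjoint (fam_disj U hU hUD X hX)
  have fam_card : ∀ U ∈ C, (fam U).card = G.card + if U ∈ D then m else 0 := by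
    intro U hU
    by_cases hUD : U ∈ D
    · rw [fam_pos U hUD, Finset.card_image_of_injective _
        (Submodule.map_injective_of_injective (hψ U hU).1), Finset.card_erase_of_mem L.W_mem,
        if_pos hUD, hm]
      rfl
    · rw [fam_neg U hUD, Finset.card_image_of_injective _
        (Submodule.map_injective_of_injective (hφ U hU).1), if_neg hUD, add_zero]
  have fam_ne : ∀ U ∈ C, ∀ U' ∈ C, U ≠ U' → ∀ X ∈ fam U, ∀ Y ∈ fam U', MeetInPoint X Y := by
    intro U hU U' hU' hne X hX Y hY
    by_cases hUD : U ∈ D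
    · by_cases hUD' : U' ∈ D
      -- Neither plane need be disjoint from `W'` here. Since `U` and `U'` are disjoint, `X ⊓ Y`
      -- lies in `W'`, which meets `X` in at most a point.
      · refine (fam_W U hU X hX).mono fun v hv => ⟨hv.1, ?_, trivial⟩
        exact Submodule.disjoint_def.1 (hD hUD hUD' hne) _ (fam_le U hU X hX hv.1).1
          (fam_le U' hU' Y hY hv.2).1
      · exact (meetInPoint_of_le_prod (hC.meetInPoint U' hU' U hU hne.symm) (fam_le U' hU' Y hY)
          (fam_le U hU X hX) (fam_disj U' hU' hUD' Y hY)).symm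
    · exact meetInPoint_of_le_prod (hC.meetInPoint U hU U' hU' hne) (fam_le U hU X hX)
          (fam_le U' hU' Y hY) (fam_disj U hU hUD X hX)
  have hWdim : Module.finrank F W' = 3 := by
    rw [hW', ← Submodule.map_inr, finrank_map_of_injective LinearMap.inr_injective, finrank_top, hK]
  have hmem : ∀ {X : Submodule F (V × K)}, X ∈ insert W' (C.biUnion fam) ↔ X = W' ∨ ∃ U ∈ C, X ∈ fam U := by
    intro X
    rw [Finset.mem_insert, Finset.mem_biUnion]
  have hEsub : ∀ {D' : Finset (Submodule F M)}, D' ⊆ G →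
      E.biUnion (fun U => D'.image (Submodule.map (φ U))) ⊆ insert W' (C.biUnion fam) := by
    intro D' hD' X hX
    obtain ⟨U, hU, hX⟩ := Finset.mem_biUnion.1 hX
    refine hmem.2 (Or.inr ⟨U, hEC hU, ?_⟩)
    -- Members of `E` lie outside `D`, so the planes over them come from `G`.
    rw [fam_neg U fun h => Finset.disjoint_left.1 hDE h hU]
    exact Finset.image_subset_image hD' hX
  have fam_disjoint : ∀ U ∈ C, ∀ U' ∈ C, U ≠ U' → Disjoint (fam U) (fam U') := by
    intro U hU U' hU' hne
    rw [Finset.disjoint_left]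
    intro X hX hX'
    exact ne_of_meetInPoint ((fam_code U hU).finrank_eq X hX)
      (fam_ne U hU U' hU' hne X hX X hX') rfl
  have hEcard : ∀ {D' : Finset (Submodule F M)}, D' ⊆ G →
      (E.biUnion (fun U => D'.image (Submodule.map (φ U)))).card = s * D'.card := by
    intro D' hD'
    rw [Finset.card_biUnion, Finset.sum_congr rfl, Finset.sum_const, hEc, smul_eq_mul]
    · intro U hU
      rw [Finset.card_image_of_injective _
        (Submodule.map_injective_of_injective (hφ U (hEC hU)).1)]
    · intro U hU U' hU' hne
      have h := fam_disjoint U (hEC hU) U' (hEC hU') hne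
      rw [fam_neg U fun h => Finset.disjoint_left.1 hDE h hU,
        fam_neg U' fun h => Finset.disjoint_left.1 hDE h hU'] at h
      exact h.mono (Finset.image_subset_image hD') (Finset.image_subset_image hD')
  refine ⟨insert W' (C.biUnion fam), E.biUnion (fun U => D₀.image (Submodule.map (φ U))),
    E.biUnion (fun U => E₀.image (Submodule.map (φ U))), ⟨?_, ?_⟩, hEsub L.D_subset_G,
    hEsub L.E_subset_G, ?_, ?_, ?_, ?_, ?_, ?_⟩
  · intro X hX
    obtain rfl | ⟨U, hU, hX⟩ := hmem.1 hX
    · exact hWdim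
    · exact (fam_code U hU).finrank_eq X hX
  · intro X hX Y hY hXY
    obtain rfl | ⟨U, hU, hX⟩ := hmem.1 hX
    · obtain rfl | ⟨U', hU', hY⟩ := hmem.1 hY
      · exact absurd rfl hXY
      · exact (fam_W U' hU' Y hY).symm
    · obtain rfl | ⟨U', hU', hY⟩ := hmem.1 hY
      · exact fam_W U hU X hX
      · by_cases hUU : U = U'
        · subst hUU
          exact (fam_code U hU).meetInPoint X hX Y hY hXY
        · exact fam_ne U hU U' hU' hUU X hX Y hY
  · rw [Finset.disjoint_left]
    intro X hX hX'
    obtain ⟨U, hU, hX⟩ := Finset.mem_biUnion.1 hX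
    obtain ⟨U', hU', hX'⟩ := Finset.mem_biUnion.1 hX'
    by_cases hUU : U = U'
    · subst hUU
      exact Finset.disjoint_left.1 ((Finset.disjoint_image
        (Submodule.map_injective_of_injective (hφ U (hEC hU)).1)).2 L.disjoint_D_E) hX hX'
    · have h : X ∈ fam U → X ∉ fam U' :=
        fun hx => Finset.disjoint_left.1 (fam_disjoint U (hEC hU) U' (hEC hU') hUU) hx
      refine h ?_ ?_
      · rw [fam_neg U fun h => Finset.disjoint_left.1 hDE h hU]
        exact Finset.image_subset_image L.D_subset_G hX
      · rw [fam_neg U' fun h => Finset.disjoint_left.1 hDE h hU']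
        exact Finset.image_subset_image L.E_subset_G hX'
  · exact pairwise_disjoint_biUnion_image hE (fun U hU => (hφ U (hEC hU)).1)
      (fun U hU => (hφ U (hEC hU)).2.2) L.pairwise_D
      fun U hU X hX => hGd U (hEC hU) X (L.D_subset_G hX)
  · exact pairwise_disjoint_biUnion_image hE (fun U hU => (hφ U (hEC hU)).1)
      (fun U hU => (hφ U (hEC hU)).2.2) L.pairwise_E
      fun U hU X hX => hGd U (hEC hU) X (L.E_subset_G hX)
  · rw [Finset.card_insert_of_notMem, Finset.card_biUnion fam_disjoint,
      Finset.sum_congr rfl fam_card, Finset.sum_add_distrib, Finset.sum_const, hCc, smul_eq_mul,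
      Finset.sum_ite_mem, Finset.inter_eq_right.2 hDC, Finset.sum_const, hDc, smul_eq_mul]
    intro h
    obtain ⟨U, hU, h⟩ := Finset.mem_biUnion.1 h
    exact ne_of_meetInPoint hWdim (fam_W U hU W' h) rfl
  · rw [hEcard L.D_subset_G, L.card_D]
  · rw [hEcard L.E_subset_G, L.card_E]

theorem IsLinkageData.hasPlaneCode {S W : Submodule F M} {G C D E : Finset (Submodule F M)}
    {r : ℕ} (L : IsLinkageData S W G C D E r) : HasPlaneCode F M C.card r :=
  ⟨C, D, E, L.isPlaneCode_C, L.D_subset_C, L.E_subset_C, L.disjoint_D_E, L.pairwise_D,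
    L.pairwise_E, rfl, L.card_D, L.card_E⟩

end Linkage

open scoped LinearAlgebra.Projectivization

/-! ### Indexed families of planes. -/

section Family

variable {F V : Type*} [Field F] [AddCommGroup V] [Module F V]

/-- A family of planes that pairwise meet in at most a projective point. -/
structure IsPlaneFamily {ι : Type*} (X : ι → Submodule F V) : Prop where
  finrank_eq : ∀ i, Module.finrank F (X i) = 3
  meetInPoint : ∀ i j, i ≠ j → MeetInPoint (X i) (X j)

namespace IsPlaneFamily

variable {ι κ : Type*} {X : ι → Submodule F V} {Y : κ → Submodule F V}

theorem injective (h : IsPlaneFamily X) : Function.Injective X := by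
  intro i j hij
  by_contra hne
  exact ne_of_meetInPoint (h.finrank_eq i) (h.meetInPoint i j hne) hij

theorem sum (hX : IsPlaneFamily X) (hY : IsPlaneFamily Y)
    (hXY : ∀ i j, MeetInPoint (X i) (Y j)) : IsPlaneFamily (Sum.elim X Y) := by
  constructor
  · rintro (_ | _)
    · exact hX.finrank_eq _
    · exact hY.finrank_eq _
  · rintro (_ | _) (_ | _) hij
    · exact hX.meetInPoint _ _ fun h => hij (by rw [h])
    · exact hXY _ _
    · exact (hXY _ _).symm
    · exact hY.meetInPoint _ _ fun h => hij (by rw [h])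

theorem comp (hX : IsPlaneFamily X) {f : κ → ι} (hf : Function.Injective f) :
    IsPlaneFamily (X ∘ f) :=
  ⟨fun _ => hX.finrank_eq _, fun _ _ hij => hX.meetInPoint _ _ (hf.ne hij)⟩

open Classical in
theorem isPlaneCode [Fintype ι] (hX : IsPlaneFamily X) : IsPlaneCode (Finset.univ.image X) := by
  constructor
  · intro U hU
    obtain ⟨i, -, rfl⟩ := Finset.mem_image.1 hU
    exact hX.finrank_eq i
  · intro U hU W hW hne
    obtain ⟨i, -, rfl⟩ := Finset.mem_image.1 hU
    obtain ⟨j, -, rfl⟩ := Finset.mem_image.1 hW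
    exact hX.meetInPoint i j fun h => hne (by rw [h])

open Classical in
theorem card_image [Fintype ι] (hX : IsPlaneFamily X) :
    (Finset.univ.image X).card = Fintype.card ι := by
  rw [Finset.card_image_of_injective _ hX.injective, Finset.card_univ]

end IsPlaneFamily

end Family

/-! ### The six-dimensional code over a cubic extension. -/

section Cubic

variable {F K : Type*} [Field F] [Field K] [Algebra F K]

/-- `σ` is an automorphism of order dividing `3` with fixed field `F` whose trace is
`Algebra.trace F K`. -/
structure IsCubicFrobenius (σ : K →ₐ[F] K) : Prop where
  cube : ∀ x, σ (σ (σ x)) = x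
  fixed : ∀ x, σ x = x → ∃ c : F, algebraMap F K c = x
  trace : ∀ x, algebraMap F K (Algebra.trace F K x) = x + σ x + σ (σ x)

/-- The map `z ↦ a σ(z) + b σ²(z)`. -/
def gabidulinMap (σ : K →ₐ[F] K) (a b : K) : K →ₗ[F] K :=
  LinearMap.mulLeft F a ∘ₗ σ.toLinearMap + LinearMap.mulLeft F b ∘ₗ σ.toLinearMap ∘ₗ σ.toLinearMap

@[simp]
theorem gabidulinMap_apply (σ : K →ₐ[F] K) (a b z : K) :
    gabidulinMap σ a b z = a * σ z + b * σ (σ z) := rfl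

/-- The cross product `x ↦ x × p`. -/
def crossMap (σ : K →ₐ[F] K) (p : K) : K →ₗ[F] K :=
  gabidulinMap σ (σ (σ p)) (-σ p)

theorem crossMap_apply (σ : K →ₐ[F] K) (p x : K) :
    crossMap σ p x = σ (σ p) * σ x - σ p * σ (σ x) := by
  simp [crossMap, sub_eq_add_neg]

/-- The linear form `x ↦ Tr (x p)`. -/
noncomputable def traceMul (F : Type*) {K : Type*} [Field F] [Field K] [Algebra F K] (p : K) :
    K →ₗ[F] F :=
  Algebra.trace F K ∘ₗ LinearMap.mulRight F p

@[simp]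
theorem traceMul_apply (p x : K) : traceMul F p x = Algebra.trace F K (x * p) := rfl

/-- The plane `{(z, f z)}` for `f = a σ + b σ²`. -/
def gabidulinPlane (σ : K →ₐ[F] K) (ab : K × K) : Submodule F (K × K) :=
  LinearMap.range (LinearMap.id.prod (gabidulinMap σ ab.1 ab.2))

/-- The plane `{(x × p, x)}`. -/
def crossPlane (σ : K →ₐ[F] K) (p : K) : Submodule F (K × K) :=
  LinearMap.range ((crossMap σ p).prod LinearMap.id)

/-- The plane `p^⊥ × ⟨p⟩`. -/
noncomputable def pointPlane (F : Type*) {K : Type*} [Field F] [Field K] [Algebra F K] (p : K) :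
    Submodule F (K × K) :=
  (LinearMap.ker (traceMul F p)).prod (Submodule.span F {p})

/-- The plane `{(Tr (x y) y, x)}`. -/
noncomputable def linePlane (F : Type*) {K : Type*} [Field F] [Field K] [Algebra F K] (y : K) :
    Submodule F (K × K) :=
  LinearMap.range (((traceMul F y).smulRight y).prod LinearMap.id)

theorem mem_gabidulinPlane {σ : K →ₐ[F] K} {ab : K × K} {v : K × K} :
    v ∈ gabidulinPlane σ ab ↔ v.2 = ab.1 * σ v.1 + ab.2 * σ (σ v.1) := by
  rw [gabidulinPlane, ← LinearMap.graph_eq_range_prod, LinearMap.mem_graph_iff,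
    gabidulinMap_apply]

theorem mem_crossPlane {σ : K →ₐ[F] K} {p : K} {v : K × K} :
    v ∈ crossPlane σ p ↔ v.1 = σ (σ p) * σ v.2 - σ p * σ (σ v.2) := by
  rw [crossPlane, LinearMap.mem_range, ← crossMap_apply]
  constructor
  · rintro ⟨x, rfl⟩
    rfl
  · intro h
    exact ⟨v.2, Prod.ext h.symm rfl⟩

theorem mem_linePlane {y : K} {v : K × K} :
    v ∈ linePlane F y ↔ v.1 = Algebra.trace F K (v.2 * y) • y := by
  rw [linePlane, LinearMap.mem_range]
  constructor
  · rintro ⟨x, rfl⟩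
    rfl
  · intro h
    exact ⟨v.2, Prod.ext h.symm rfl⟩

theorem mem_pointPlane {p : K} {v : K × K} :
    v ∈ pointPlane F p ↔ Algebra.trace F K (v.1 * p) = 0 ∧ v.2 ∈ Submodule.span F {p} := by
  rw [pointPlane, Submodule.mem_prod, LinearMap.mem_ker, traceMul_apply]

theorem finrank_gabidulinPlane (σ : K →ₐ[F] K) (ab : K × K) :
    Module.finrank F (gabidulinPlane σ ab) = Module.finrank F K :=
  LinearMap.finrank_range_of_inj fun _ _ h => congrArg Prod.fst h

theorem finrank_crossPlane (σ : K →ₐ[F] K) (p : K) :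
    Module.finrank F (crossPlane σ p) = Module.finrank F K :=
  LinearMap.finrank_range_of_inj fun _ _ h => congrArg Prod.snd h

theorem finrank_linePlane (y : K) :
    Module.finrank F (linePlane F y) = Module.finrank F K :=
  LinearMap.finrank_range_of_inj fun _ _ h => congrArg Prod.snd h

theorem finrank_pointPlane [FiniteDimensional F K] [Algebra.IsSeparable F K] {p : K} (hp : p ≠ 0) :
    Module.finrank F (pointPlane F p) = Module.finrank F K := by
  have hne : traceMul F p ≠ 0 := by
    intro h
    refine Algebra.trace_ne_zero F K (LinearMap.ext fun x => ?_)
    simpa [hp] using LinearMap.congr_fun h (x * p⁻¹)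
  have h1 := Module.Dual.finrank_ker_add_one_of_ne_zero hne
  have h2 : pointPlane F p = LinearMap.range
      ((LinearMap.ker (traceMul F p)).subtype.prodMap (Submodule.span F {p}).subtype) := by
    rw [LinearMap.range_prodMap, Submodule.range_subtype, Submodule.range_subtype, pointPlane]
  rw [h2, LinearMap.finrank_range_of_inj, Module.finrank_prod, finrank_span_singleton hp, h1]
  exact Function.Injective.prodMap Subtype.val_injective Subtype.val_injective

namespace IsCubicFrobenius

variable {σ : K →ₐ[F] K}

theorem exists_smul (hσ : IsCubicFrobenius σ) {z w : K} (hz : z ≠ 0) (h : z * σ w - w * σ z = 0) :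
    ∃ c : F, w = c • z := by
  have hz' : σ z ≠ 0 := (map_ne_zero σ).2 hz
  obtain ⟨c, hc⟩ := hσ.fixed (w / z) (by
    rw [map_div₀, div_eq_div_iff hz' hz]
    linear_combination h)
  exact ⟨c, by rw [Algebra.smul_def, hc, div_mul_cancel₀ _ hz]⟩

/-- The two equations are linear in `(a, b)`, with determinant σ(z σ(w) - w σ(z)); a nonzero
solution forces it to vanish. -/
theorem exists_smul_of_gabidulinMap (hσ : IsCubicFrobenius σ) {a b z w : K} (hab : (a, b) ≠ 0) (hz : z ≠ 0)
    (h1 : a * σ z + b * σ (σ z) = 0) (h2 : a * σ w + b * σ (σ w) = 0) : ∃ c : F, w = c • z := by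
  refine hσ.exists_smul hz ((map_eq_zero σ).1 ?_)
  rw [map_sub, map_mul, map_mul]
  have ha : a * (σ z * σ (σ w) - σ w * σ (σ z)) = 0 := by
    linear_combination σ (σ w) * h1 - σ (σ z) * h2
  have hb : b * (σ z * σ (σ w) - σ w * σ (σ z)) = 0 := by
    linear_combination σ z * h2 - σ w * h1
  by_contra h
  exact hab (Prod.ext ((mul_eq_zero.1 ha).resolve_right h) ((mul_eq_zero.1 hb).resolve_right h))

theorem exists_smul_of_perp (hσ : IsCubicFrobenius σ) {x w y y' : K} (hy : ∀ c : F, y' ≠ c • y) (hy0 : y ≠ 0) (hx : x ≠ 0)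
    (h1 : Algebra.trace F K (x * y) = 0) (h2 : Algebra.trace F K (x * y') = 0)
    (h3 : Algebra.trace F K (w * y) = 0) (h4 : Algebra.trace F K (w * y') = 0) :
    ∃ c : F, w = c • x := by
  have key : ∀ {u v}, Algebra.trace F K (u * v) = 0 →
      u * v + σ u * σ v + σ (σ u) * σ (σ v) = 0 := by
    intro u v h
    have := hσ.trace (u * v)
    rw [h, map_zero] at this
    simpa only [map_mul] using this.symm
  have k1 := key h1
  have k2 := key h2
  have k3 := key h3
  have k4 := key h4
  -- In conjugate coordinates the trace is a dot product. Eliminating `x` and `w`, and then the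
  -- common factor y σ²(y') - y' σ²(y), leaves a product of two 2 × 2 minors.
  have h : (y * σ y' - y' * σ y) * σ (x * σ w - w * σ x) = 0 := by
    rw [map_sub, map_mul, map_mul]
    linear_combination σ (σ w) * (y * k2 - y' * k1) - σ (σ x) * (y * k4 - y' * k3)
  rcases mul_eq_zero.1 h with h | h
  · obtain ⟨c, hc⟩ := hσ.exists_smul hy0 h
    exact absurd hc (hy c)
  · exact hσ.exists_smul hx ((map_eq_zero σ).1 h)

/-- The quadratic form `z ↦ Tr (c z σ(z))` is not identically zero on any plane `⟨z, w⟩`. -/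
theorem exists_smul_of_quadric (hσ : IsCubicFrobenius σ) {c z w : K} (hc : c ≠ 0) (hz : z ≠ 0)
    (h1 : Algebra.trace F K (c * z * σ z) = 0) (h2 : Algebra.trace F K (c * w * σ w) = 0)
    (h3 : Algebra.trace F K (c * (z + w) * σ (z + w)) = 0) : ∃ c : F, w = c • z := by
  have k1 := hσ.trace (c * z * σ z)
  have k2 := hσ.trace (c * w * σ w)
  have k3 := hσ.trace (c * (z + w) * σ (z + w))
  rw [h1, map_zero] at k1
  rw [h2, map_zero] at k2
  rw [h3, map_zero] at k3
  simp only [map_mul, map_add, hσ.cube] at k1 k2 k3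
  have hm1 : σ (z * σ w - w * σ z) = σ z * σ (σ w) - σ w * σ (σ z) := by simp
  have hm2 : σ (σ (z * σ w - w * σ z)) = σ (σ z) * w - σ (σ w) * z := by simp [hσ.cube]
  have h : c * (z * σ w - w * σ z) * σ (z * σ w - w * σ z) * σ (σ (z * σ w - w * σ z)) = 0 := by
    rw [hm2, hm1]
    generalize σ (σ z) = z2 at *
    generalize σ (σ w) = w2 at *
    generalize σ (σ c) = c2 at *
    generalize σ z = z1 at *
    generalize σ w = w1 at *
    generalize σ c = c1 at *
    -- Cramer's rule for three equations linear in c, σ(c), σ²(c), the third being the polar form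
    -- `k3 - k1 - k2`. Up to sign the determinant is the norm of z σ(w) - w σ(z).
    linear_combination (w1 * w2 * (z2 * w + z * w2) - w2 * w * (z1 * w2 + z2 * w1)) * k1
      - (z1 * z2 * (z2 * w + z * w2) - z2 * z * (z1 * w2 + z2 * w1)) * k2
      + (z1 * z2 * (w2 * w) - z2 * z * (w1 * w2)) * (k3 - k1 - k2)
  refine hσ.exists_smul hz ?_
  by_contra hm
  exact mul_ne_zero (mul_ne_zero (mul_ne_zero hc hm) ((map_ne_zero σ).2 hm))
    ((map_ne_zero σ).2 ((map_ne_zero σ).2 hm)) h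

theorem trace_map (hσ : IsCubicFrobenius σ) (x : K) : Algebra.trace F K (σ x) = Algebra.trace F K x := by
  apply (algebraMap F K).injective
  rw [hσ.trace, hσ.trace, hσ.cube]
  ring

/-- The element is a difference u - σ²(u), whose trace vanishes. -/
theorem trace_cross (hσ : IsCubicFrobenius σ) (x p : K) :
    Algebra.trace F K (x * (σ (σ p) * σ x - σ p * σ (σ x))) = 0 := by
  have h : x * (σ (σ p) * σ x - σ p * σ (σ x)) =
      σ (σ p) * σ x * x - σ (σ (σ (σ p) * σ x * x)) := by
    simp only [map_mul, hσ.cube]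
    ring
  rw [h, map_sub, hσ.trace_map, hσ.trace_map, sub_self]

theorem meetInPoint_gabidulinPlane (hσ : IsCubicFrobenius σ) {s t : K × K} (h : s ≠ t) :
    MeetInPoint (gabidulinPlane σ s) (gabidulinPlane σ t) := by
  refine .of_forall fun v hv hv' w hw hw' hv0 => ?_
  rw [mem_gabidulinPlane] at hv hv' hw hw'
  have hz : v.1 ≠ 0 := by
    intro h0
    rw [h0] at hv
    exact hv0 (Prod.ext h0 (by simpa using hv))
  obtain ⟨c, hc⟩ := hσ.exists_smul_of_gabidulinMap (a := s.1 - t.1) (b := s.2 - t.2) (z := v.1)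
    (w := w.1) (fun h0 => h (sub_eq_zero.1 h0)) hz (by linear_combination hv' - hv)
    (by linear_combination hw' - hw)
  refine ⟨c, Prod.ext hc ?_⟩
  rw [hw, hc, Prod.smul_snd, hv]
  simp [smul_add]

/-- Invariance of the trace under `σ` turns Tr(z f(z)) into Tr((a + σ b) z σ(z)), to which
`exists_smul_of_quadric` applies. -/
theorem meetInPoint_of_isotropic (hσ : IsCubicFrobenius σ) {a b : K} (hab : a + σ b ≠ 0) {N : Submodule F (K × K)}
    (hN : ∀ v ∈ N, Algebra.trace F K (v.1 * v.2) = 0) :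
    MeetInPoint (gabidulinPlane σ (a, b)) N := by
  have key : ∀ v ∈ gabidulinPlane σ (a, b), v ∈ N →
      Algebra.trace F K ((a + σ b) * v.1 * σ v.1) = 0 := by
    intro v hv hvN
    have h := hN v hvN
    rw [mem_gabidulinPlane] at hv
    have h' : v.1 * v.2 = a * v.1 * σ v.1 + b * v.1 * σ (σ v.1) := by
      rw [hv]
      ring
    rw [h', map_add, ← hσ.trace_map (b * v.1 * σ (σ v.1)), ← map_add] at h
    rw [← h]
    simp only [map_mul, hσ.cube]
    ring_nf
  refine .of_forall fun v hv hv' w hw hw' hv0 => ?_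
  have k1 := key v hv hv'
  have k2 := key w hw hw'
  have k3 := key (v + w) (add_mem hv hw) (add_mem hv' hw')
  rw [mem_gabidulinPlane] at hv hw
  have hz : v.1 ≠ 0 := by
    intro h0
    rw [h0] at hv
    exact hv0 (Prod.ext h0 (by simpa using hv))
  obtain ⟨c, hc⟩ := hσ.exists_smul_of_quadric hab hz k1 k2 k3
  refine ⟨c, Prod.ext hc ?_⟩
  rw [hw, hc, Prod.smul_snd, hv]
  simp [smul_add]

/-- First coordinates in `linePlane F y` are multiples of `y`, and a vector of a graph is determined
by its first coordinate. -/
theorem meetInPoint_gabidulinPlane_linePlane (s : K × K) (y : K) :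
    MeetInPoint (gabidulinPlane σ s) (linePlane F y) := by
  refine .of_forall fun v hv hv' w hw hw' hv0 => ?_
  rw [mem_gabidulinPlane] at hv hw
  rw [mem_linePlane] at hv' hw'
  have ht : Algebra.trace F K (v.2 * y) ≠ 0 := by
    intro h0
    rw [h0, zero_smul] at hv'
    rw [hv'] at hv
    exact hv0 (Prod.ext hv' (by simpa using hv))
  have hc : w.1 = (Algebra.trace F K (w.2 * y) / Algebra.trace F K (v.2 * y)) • v.1 := by
    refine Eq.trans ?_ (congrArg _ hv'.symm)
    rw [hw', smul_smul, div_mul_cancel₀ _ ht]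
  generalize Algebra.trace F K (w.2 * y) / Algebra.trace F K (v.2 * y) = c at hc
  refine ⟨c, Prod.ext hc ?_⟩
  rw [hw, hc, Prod.smul_snd, hv]
  simp [smul_add]

theorem crossMap_eq_zero (hσ : IsCubicFrobenius σ) {p x : K} (hp : p ≠ 0)
    (h : σ (σ p) * σ x - σ p * σ (σ x) = 0) : x ∈ Submodule.span F {p} := by
  obtain ⟨c, hc⟩ := hσ.exists_smul hp (w := x) ((map_eq_zero σ).1 (by
    rw [map_sub, map_mul, map_mul]
    linear_combination -h))
  exact Submodule.mem_span_singleton.2 ⟨c, hc.symm⟩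

theorem eq_zero_of_snd_crossPlane {p : K} : ∀ v ∈ crossPlane σ p, v.2 = 0 → v = 0 := by
  intro v hv h0
  rw [mem_crossPlane, h0] at hv
  exact Prod.ext (by simpa using hv) h0

theorem eq_zero_of_snd_linePlane {y : K} : ∀ v ∈ linePlane F y, v.2 = 0 → v = 0 := by
  intro v hv h0
  rw [mem_linePlane, h0] at hv
  exact Prod.ext (by simpa using hv) h0

/-- The cross product is additive in `p`, so a common vector has second coordinate parallel to `p -
p'`. Proportional `p`, `p'` are therefore allowed. -/
theorem meetInPoint_crossPlane [FiniteDimensional F K] (hσ : IsCubicFrobenius σ) {p p' : K}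
    (h : p ≠ p') : MeetInPoint (crossPlane σ p) (crossPlane σ p') := by
  refine .of_map_le (LinearMap.snd F K K) eq_zero_of_snd_crossPlane
    (finrank_span_singleton (sub_ne_zero.2 h)).le fun v hv hv' => ?_
  rw [mem_crossPlane] at hv hv'
  refine hσ.crossMap_eq_zero (sub_ne_zero.2 h) ?_
  simp only [map_sub, LinearMap.snd_apply]
  linear_combination hv' - hv

theorem meetInPoint_crossPlane_pointPlane [FiniteDimensional F K] (p : K) {p' : K}
    (h : p' ≠ 0) : MeetInPoint (crossPlane σ p) (pointPlane F p') :=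
  .of_map_le (LinearMap.snd F K K) eq_zero_of_snd_crossPlane
    (finrank_span_singleton h).le fun _ _ hv' => (mem_pointPlane.1 hv').2

theorem meetInPoint_linePlane_pointPlane [FiniteDimensional F K] (y : K) {p : K}
    (h : p ≠ 0) : MeetInPoint (linePlane F y) (pointPlane F p) :=
  .of_map_le (LinearMap.snd F K K) eq_zero_of_snd_linePlane
    (finrank_span_singleton h).le fun _ _ hv' => (mem_pointPlane.1 hv').2

/-- Tr(v₁v₂) vanishes on the first plane and equals Tr(v₂y)² on the second. Hence v₁ = 0 and v₂ is
parallel to `p`. -/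
theorem meetInPoint_crossPlane_linePlane [FiniteDimensional F K] (hσ : IsCubicFrobenius σ)
    {p y : K} (hp : p ≠ 0) : MeetInPoint (crossPlane σ p) (linePlane F y) := by
  refine .of_map_le (LinearMap.snd F K K) eq_zero_of_snd_crossPlane
    (finrank_span_singleton hp).le fun v hv hv' => hσ.crossMap_eq_zero hp ?_
  rw [mem_crossPlane] at hv
  rw [mem_linePlane] at hv'
  have h := hσ.trace_cross v.2 p
  rw [← hv, hv', mul_smul_comm, map_smul, smul_eq_mul, mul_self_eq_zero] at h
  rw [h, zero_smul] at hv'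
  rw [LinearMap.snd_apply, ← hv, hv']

theorem meetInPoint_pointPlane (hσ : IsCubicFrobenius σ) {p p' : K} (hp : p ≠ 0)
    (h : ∀ c : F, p' ≠ c • p) : MeetInPoint (pointPlane F p) (pointPlane F p') := by
  have key : ∀ v : K × K, v ∈ pointPlane F p → v ∈ pointPlane F p' → v.2 = 0 := by
    intro v hv hv'
    obtain ⟨a, ha⟩ := Submodule.mem_span_singleton.1 (mem_pointPlane.1 hv).2
    obtain ⟨b, hb⟩ := Submodule.mem_span_singleton.1 (mem_pointPlane.1 hv').2
    by_cases hb0 : b = 0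
    · rw [← hb, hb0, zero_smul]
    · refine absurd ?_ (h (b⁻¹ * a))
      rw [mul_smul, ha, ← hb, inv_smul_smul₀ hb0]
  refine .of_forall fun v hv hv' w hw hw' hv0 => ?_
  have k1 := key v hv hv'
  have k2 := key w hw hw'
  obtain ⟨c, hc⟩ := hσ.exists_smul_of_perp h hp
    (fun h0 : v.1 = 0 => hv0 (Prod.ext h0 k1)) (mem_pointPlane.1 hv).1 (mem_pointPlane.1 hv').1
    (mem_pointPlane.1 hw).1 (mem_pointPlane.1 hw').1
  exact ⟨c, Prod.ext hc (by rw [k2, Prod.smul_snd, k1, smul_zero])⟩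

theorem meetInPoint_linePlane (hσ : IsCubicFrobenius σ) {y y' : K} (hy : y ≠ 0)
    (h : ∀ c : F, y' ≠ c • y) : MeetInPoint (linePlane F y) (linePlane F y') := by
  have key : ∀ v : K × K, v ∈ linePlane F y → v ∈ linePlane F y' →
      Algebra.trace F K (v.2 * y) = 0 ∧ Algebra.trace F K (v.2 * y') = 0 ∧ v.1 = 0 := by
    intro v hv hv'
    rw [mem_linePlane] at hv hv'
    have h' : Algebra.trace F K (v.2 * y') = 0 := by
      by_contra h0
      refine h ((Algebra.trace F K (v.2 * y'))⁻¹ * Algebra.trace F K (v.2 * y)) ?_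
      rw [mul_smul, ← hv, hv', inv_smul_smul₀ h0]
    rw [h', zero_smul] at hv'
    rw [hv', eq_comm, smul_eq_zero_iff_left hy] at hv
    exact ⟨hv, h', hv'⟩
  refine .of_forall fun v hv hv' w hw hw' hv0 => ?_
  obtain ⟨k1, k2, k3⟩ := key v hv hv'
  obtain ⟨l1, l2, l3⟩ := key w hw hw'
  obtain ⟨c, hc⟩ := hσ.exists_smul_of_perp h hy
    (fun h0 : v.2 = 0 => hv0 (Prod.ext k3 h0)) k1 k2 l1 l2
  exact ⟨c, Prod.ext (by rw [l3, Prod.smul_fst, k3, smul_zero]) hc⟩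

theorem trace_of_mem_crossPlane (hσ : IsCubicFrobenius σ) {p : K} :
    ∀ v ∈ crossPlane σ p, Algebra.trace F K (v.1 * v.2) = 0 := by
  intro v hv
  rw [mem_crossPlane.1 hv, mul_comm, hσ.trace_cross]

theorem trace_of_mem_pointPlane {p : K} :
    ∀ v ∈ pointPlane F p, Algebra.trace F K (v.1 * v.2) = 0 := by
  intro v hv
  obtain ⟨h, h'⟩ := mem_pointPlane.1 hv
  obtain ⟨a, ha⟩ := Submodule.mem_span_singleton.1 h'
  rw [← ha, mul_smul_comm, map_smul, h, smul_zero]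

/-- The planes `{(z, f z)}` for all `f = a σ + b σ²`. -/
theorem isPlaneFamily_gabidulinPlane (hσ : IsCubicFrobenius σ) (hK : Module.finrank F K = 3) :
    IsPlaneFamily (gabidulinPlane σ) :=
  ⟨fun s => (finrank_gabidulinPlane σ s).trans hK, fun _ _ h => hσ.meetInPoint_gabidulinPlane h⟩

/-- The planes of a code of size `q ^ 6 + 2 * q ^ 2 + 2 * q + 1`. -/
noncomputable def codePlane (σ : K →ₐ[F] K) :
    ({c : K // c ≠ 0} × K) ⊕ ({p : K // p ≠ 0} ⊕ (ℙ F K ⊕ ℙ F K)) → Submodule F (K × K) :=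
  -- The index (c, b) stands for the graph with a + σ b = c.
  Sum.elim (fun i => gabidulinPlane σ (i.1 - σ i.2, i.2))
    (Sum.elim (fun p => crossPlane σ p)
      (Sum.elim (fun v => linePlane F v.rep) (fun v => pointPlane F v.rep)))

theorem rep_ne_smul_rep {v w : ℙ F K} (h : v ≠ w) (c : F) : w.rep ≠ c • v.rep := by
  intro hc
  apply h
  rw [← v.mk_rep, ← w.mk_rep, eq_comm, Projectivization.mk_eq_mk_iff']
  exact ⟨c, hc.symm⟩

theorem isPlaneFamily_codePlane [FiniteDimensional F K] [Algebra.IsSeparable F K]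
    (hσ : IsCubicFrobenius σ) (hK : Module.finrank F K = 3) : IsPlaneFamily (codePlane σ) := by
  refine .sum ?_ (.sum ?_ (.sum ?_ ?_ ?_) ?_) ?_
  · refine (hσ.isPlaneFamily_gabidulinPlane hK).comp
      (f := fun i : {c : K // c ≠ 0} × K => (i.1 - σ i.2, i.2)) fun i j h => ?_
    obtain ⟨h1, h2⟩ := Prod.mk.inj h
    rw [h2, sub_left_inj] at h1
    exact Prod.ext (Subtype.ext h1) h2
  · exact ⟨fun p => (finrank_crossPlane σ _).trans hK,
      fun p p' h => hσ.meetInPoint_crossPlane fun h' => h (Subtype.ext h')⟩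
  · exact ⟨fun v => (finrank_linePlane _).trans hK,
      fun v w h => hσ.meetInPoint_linePlane v.rep_nonzero (rep_ne_smul_rep h)⟩
  · exact ⟨fun v => (finrank_pointPlane v.rep_nonzero).trans hK,
      fun v w h => hσ.meetInPoint_pointPlane v.rep_nonzero (rep_ne_smul_rep h)⟩
  · exact fun v w => meetInPoint_linePlane_pointPlane _ w.rep_nonzero
  · rintro ⟨p, hp⟩ (v | w)
    · exact hσ.meetInPoint_crossPlane_linePlane hp
    · exact meetInPoint_crossPlane_pointPlane _ w.rep_nonzero
  · rintro ⟨⟨c, hc⟩, b⟩ (p | v | w)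
    · exact hσ.meetInPoint_of_isotropic (by simpa using hc) hσ.trace_of_mem_crossPlane
    · exact meetInPoint_gabidulinPlane_linePlane _ _
    · exact hσ.meetInPoint_of_isotropic (by simpa using hc) trace_of_mem_pointPlane

open Classical in
theorem exists_isLinkageData [Finite F] [Finite K] (hσ : IsCubicFrobenius σ)
    (hK : Module.finrank F K = 3) :
    ∃ (S W : Submodule F (K × K)) (G C D E : Finset (Submodule F (K × K))),
      IsLinkageData S W G C D E (Nat.card F ^ 3 - 1) ∧ G.card = Nat.card F ^ 6 ∧
      C.card = Nat.card F ^ 6 + (2 * Nat.card F ^ 2 + 2 * Nat.card F) + 1 := by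
  have := Fintype.ofFinite K
  have := Fintype.ofFinite (ℙ F K)
  have hq : 1 < Nat.card F := Finite.one_lt_card
  have hKq : Fintype.card K = Nat.card F ^ 3 := by
    rw [Fintype.card_eq_nat_card, Module.natCard_eq_pow_finrank (K := F), hK]
  have hne : Fintype.card {c : K // c ≠ 0} = Nat.card F ^ 3 - 1 := by
    rw [Fintype.card_subtype_compl, Fintype.card_subtype_eq, hKq]
  have hP : Fintype.card (ℙ F K) = Nat.card F ^ 2 + Nat.card F + 1 := by
    rw [Fintype.card_eq_nat_card, Projectivization.card_of_finrank F K hK]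
    simp [Finset.sum_range_succ]
    ring
  have hG := hσ.isPlaneFamily_gabidulinPlane hK
  have hC := hσ.isPlaneFamily_codePlane hK
  have hD : Function.Injective fun a : {c : K // c ≠ 0} => gabidulinPlane σ (a.1, 0) :=
    fun a b h => Subtype.ext (congrArg Prod.fst (hG.injective h))
  have hE : Function.Injective fun b : {c : K // c ≠ 0} => gabidulinPlane σ (0, b.1) :=
    fun a b h => Subtype.ext (congrArg Prod.snd (hG.injective h))
  have hCcard : (Finset.univ.image (codePlane σ)).card =
      Nat.card F ^ 6 + (2 * Nat.card F ^ 2 + 2 * Nat.card F) + 1 := by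
    -- The count is (q^3 - 1)q^3 + (q^3 - 1) + 2(q^2 + q + 1).
    rw [hC.card_image, Fintype.card_sum, Fintype.card_sum, Fintype.card_sum, Fintype.card_prod,
      hne, hP, hKq]
    have h1 : 1 ≤ Nat.card F ^ 3 := Nat.one_le_pow _ _ (by omega)
    zify [h1]
    ring
  -- Any member can serve as `W`.
  obtain ⟨W, hW⟩ : (Finset.univ.image (codePlane σ)).Nonempty := by
    rw [← Finset.card_pos, hCcard]
    omega
  refine ⟨(⊥ : Submodule F K).prod ⊤, W, Finset.univ.image (gabidulinPlane σ),
    Finset.univ.image (codePlane σ),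
    Finset.univ.image fun a : {c : K // c ≠ 0} => gabidulinPlane σ (a.1, 0),
    Finset.univ.image fun b : {c : K // c ≠ 0} => gabidulinPlane σ (0, b.1),
    ?_, ?_, hCcard⟩
  · refine ⟨?_, hG.isPlaneCode, ?_, hC.isPlaneCode, hW, ?_, ?_, ?_, ?_, ?_, ?_, ?_, ?_, ?_⟩
    · rw [← Submodule.map_inr, finrank_map_of_injective LinearMap.inr_injective, finrank_top, hK]
    · intro X hX
      obtain ⟨s, -, rfl⟩ := Finset.mem_image.1 hX
      rw [Submodule.disjoint_def]
      rintro v hv ⟨h0 : v.1 = 0, -⟩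
      rw [mem_gabidulinPlane, h0] at hv
      exact Prod.ext h0 (by simpa using hv)
    · intro X hX
      obtain ⟨a, -, rfl⟩ := Finset.mem_image.1 hX
      exact Finset.mem_image_of_mem _ (Finset.mem_univ _)
    · intro X hX
      obtain ⟨a, -, rfl⟩ := Finset.mem_image.1 hX
      exact Finset.mem_image_of_mem _ (Finset.mem_univ _)
    · intro X hX
      obtain ⟨a, -, rfl⟩ := Finset.mem_image.1 hX
      refine Finset.mem_image.2 ⟨Sum.inl (a, 0), Finset.mem_univ _, ?_⟩
      simp [codePlane]
    · intro X hX
      obtain ⟨b, -, rfl⟩ := Finset.mem_image.1 hX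
      refine Finset.mem_image.2 ⟨Sum.inl (⟨σ b.1, (map_ne_zero σ).2 b.2⟩, b.1),
        Finset.mem_univ _, ?_⟩
      simp [codePlane]
    · rw [Finset.disjoint_left]
      intro X hX hX'
      obtain ⟨a, -, rfl⟩ := Finset.mem_image.1 hX
      obtain ⟨b, -, h⟩ := Finset.mem_image.1 hX'
      exact b.2 (congrArg Prod.snd (hG.injective h))
    · intro X hX Y hY hXY
      obtain ⟨a, -, rfl⟩ := Finset.mem_image.1 (Finset.mem_coe.1 hX)
      obtain ⟨b, -, rfl⟩ := Finset.mem_image.1 (Finset.mem_coe.1 hY)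
      have hab : a.1 - b.1 ≠ 0 := fun h => hXY (by rw [sub_eq_zero.1 h])
      rw [Submodule.disjoint_def]
      intro v hv hv'
      rw [mem_gabidulinPlane] at hv hv'
      -- Distinct multiples of `σ` differ by an injective map, so their graphs are disjoint.
      have h : (a.1 - b.1) * σ v.1 = 0 := by linear_combination hv' - hv
      have h0 : v.1 = 0 := (map_eq_zero σ).1 ((mul_eq_zero.1 h).resolve_left hab)
      exact Prod.ext h0 (by simpa [h0] using hv)
    · intro X hX Y hY hXY
      obtain ⟨a, -, rfl⟩ := Finset.mem_image.1 (Finset.mem_coe.1 hX)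
      obtain ⟨b, -, rfl⟩ := Finset.mem_image.1 (Finset.mem_coe.1 hY)
      have hab : a.1 - b.1 ≠ 0 := fun h => hXY (by rw [sub_eq_zero.1 h])
      rw [Submodule.disjoint_def]
      intro v hv hv'
      rw [mem_gabidulinPlane] at hv hv'
      have h : (a.1 - b.1) * σ (σ v.1) = 0 := by linear_combination hv' - hv
      have h0 : v.1 = 0 :=
        (map_eq_zero σ).1 ((map_eq_zero σ).1 ((mul_eq_zero.1 h).resolve_left hab))
      exact Prod.ext h0 (by simpa [h0] using hv)
    · rw [Finset.card_image_of_injective _ hD, Finset.card_univ, hne]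
    · rw [Finset.card_image_of_injective _ hE, Finset.card_univ, hne]
  · rw [hG.card_image, Fintype.card_prod, hKq]
    ring

end IsCubicFrobenius

end Cubic

/-! ### Existence of the cubic extension, and the final count. -/

section Existence

theorem exists_isCubicFrobenius (F : Type*) [Field F] [Finite F] :
    ∃ (K : Type) (_ : Field K) (_ : Algebra F K) (_ : Finite K) (σ : K →ₐ[F] K),
      IsCubicFrobenius σ ∧ Module.finrank F K = 3 := by
  have := Fintype.ofFinite F
  obtain ⟨p, hp⟩ := CharP.exists F
  have : Fact p.Prime := ⟨CharP.char_is_prime F p⟩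
  let K := FiniteField.Extension F p 3
  have := Fintype.ofFinite K
  have hK : Module.finrank F K = 3 := FiniteField.finrank_extension F p 3
  have hcard : Fintype.card K = Fintype.card F ^ 3 := by
    rw [Module.card_eq_pow_finrank (K := F), hK]
  have hσ : ∀ x, FiniteField.frobeniusAlgHom F K x = x ^ Fintype.card F := fun _ => rfl
  refine ⟨K, inferInstance, inferInstance, inferInstance, FiniteField.frobeniusAlgHom F K,
    ⟨?_, ?_, ?_⟩, hK⟩
  · intro x
    rw [hσ, hσ, hσ, ← pow_mul, ← pow_mul, ← pow_three, ← hcard, FiniteField.pow_card]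
  · intro x hx
    -- Powers of the Frobenius exhaust the Galois group, so being fixed by it suffices.
    refine (IsGalois.mem_range_algebraMap_iff_fixed x).2 fun g => ?_
    obtain ⟨n, -, rfl⟩ := FiniteField.Extension.exists_frob_pow_eq F p 3 g
    have hx' : FiniteField.Extension.frob F p 3 x = x := by
      rw [FiniteField.Extension.frob_apply, Nat.card_eq_fintype_card]
      exact hx
    induction n with
    | zero => rfl
    | succ n ih => rw [pow_succ, AlgEquiv.mul_apply, hx', ih]
  · intro x
    rw [FiniteField.algebraMap_trace_eq_sum_pow, hK]
    simp [Finset.sum_range_succ, hσ, ← pow_mul, sq]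

end Existence

theorem IsPlaneCode.isConstantDimensionCode {F V : Type*} [Field F] [AddCommGroup V] [Module F V]
    [FiniteDimensional F V] {C : Finset (Submodule F V)} (hC : IsPlaneCode C) :
    IsConstantDimensionCode 4 3 (C : Set (Submodule F V)) := by
  refine ⟨fun U hU => hC.finrank_eq U hU, fun U hU W hW hne => ?_⟩
  have h1 := hC.meetInPoint U hU W hW hne
  have h2 := Submodule.finrank_sup_add_finrank_inf_eq U W
  rw [hC.finrank_eq U hU, hC.finrank_eq W hW] at h2
  unfold MeetInPoint at h1
  unfold subspaceDist
  omega

/-- The sizes of the codes obtained from a `6`-dimensional one by repeated linkage. -/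
def linkageSize (q : ℕ) : ℕ → ℕ
  | 0 => q ^ 6 + (2 * q ^ 2 + 2 * q) + 1
  -- The exponent is `t + 1` because the disjoint families already have q^3 - 1 members at stage 0.
  | t + 1 => linkageSize q t * q ^ 6 + (q ^ 3 - 1) ^ (t + 1) * (2 * q ^ 2 + 2 * q) + 1

theorem hasPlaneCode_linkageSize (F : Type*) [Field F] [Finite F] (t : ℕ) :
    HasPlaneCode F (Fin (6 + 3 * t) → F) (linkageSize (Nat.card F) t)
      ((Nat.card F ^ 3 - 1) ^ (t + 1)) := by
  obtain ⟨K, _, _, _, σ, hσ, hK⟩ := exists_isCubicFrobenius F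
  obtain ⟨S, W, G, C, D, E, L, hG, hC⟩ := hσ.exists_isLinkageData hK
  have hM : Module.finrank F (K × K) = 6 := by rw [Module.finrank_prod, hK]
  induction t with
  | zero =>
    have h := L.hasPlaneCode
    rw [hC] at h
    simpa using! h.map (LinearEquiv.ofFinrankEq (K × K) (Fin (6 + 3 * 0) → F) (by simp [hM]))
  | succ t ih =>
    have h := ih.linkage hM hK L (m := 2 * Nat.card F ^ 2 + 2 * Nat.card F) (by rw [hC, hG])
    rw [hG, ← pow_succ] at h
    exact h.map (LinearEquiv.ofFinrankEq _ _ (by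
      rw [Module.finrank_prod, hK, Module.finrank_fin_fun, Module.finrank_fin_fun]
      ring))

/-- Every later step multiplies by q^6. The planes added singly thus sum to the geometric quotient,
and the gain of step i acquires the factor q^(6(t-i)). -/
theorem linkageSize_cast {q : ℕ} (hq : 1 < q) (t : ℕ) :
    (linkageSize q t : ℚ) =
      ((q : ℚ) ^ 6 + 2 * (q : ℚ) ^ 2 + 2 * (q : ℚ) + 1) * (q : ℚ) ^ (6 * t)
        + ((q : ℚ) ^ (6 * t) - 1) / ((q : ℚ) ^ 6 - 1)
        + ∑ i ∈ Finset.Icc 1 t,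
            (2 * (q : ℚ) ^ 2 + 2 * (q : ℚ)) * ((q : ℚ) ^ 3 - 1) ^ i * (q : ℚ) ^ (6 * (t - i)) := by
  have hq6 : (q : ℚ) ^ 6 - 1 ≠ 0 := by
    have : (1 : ℚ) < q := by exact_mod_cast hq
    exact sub_ne_zero.2 (one_lt_pow₀ this (by norm_num)).ne'
  have h3 : ((q ^ 3 - 1 : ℕ) : ℚ) = (q : ℚ) ^ 3 - 1 := by
    rw [Nat.cast_sub (Nat.one_le_pow _ _ (by omega))]
    simp
  induction t with
  | zero =>
    simp [linkageSize]
    ring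
  | succ t ih =>
    have hs : ∑ i ∈ Finset.Icc 1 t, (2 * (q : ℚ) ^ 2 + 2 * (q : ℚ)) * ((q : ℚ) ^ 3 - 1) ^ i *
          (q : ℚ) ^ (6 * (t + 1 - i)) =
        (∑ i ∈ Finset.Icc 1 t, (2 * (q : ℚ) ^ 2 + 2 * (q : ℚ)) * ((q : ℚ) ^ 3 - 1) ^ i *
          (q : ℚ) ^ (6 * (t - i))) * (q : ℚ) ^ 6 := by
      rw [Finset.sum_mul]
      refine Finset.sum_congr rfl fun i hi => ?_
      have : 6 * (t + 1 - i) = 6 * (t - i) + 6 := by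
        have := (Finset.mem_Icc.1 hi).2
        omega
      rw [this, pow_add]
      ring
    have hd : ((q : ℚ) ^ (6 * (t + 1)) - 1) / ((q : ℚ) ^ 6 - 1) =
        ((q : ℚ) ^ (6 * t) - 1) / ((q : ℚ) ^ 6 - 1) * (q : ℚ) ^ 6 + 1 := by
      field_simp
      ring
    rw [Finset.sum_Icc_succ_top (by omega), hs, hd, Nat.sub_self, linkageSize]
    push_cast
    rw [ih, h3]
    ring

theorem mainTheorem3 {F : Type*} [Field F] [Fintype F] (q : ℕ) (hq : Fintype.card F = q) (t : ℕ) :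
    ((q : ℚ) ^ 6 + 2 * (q : ℚ) ^ 2 + 2 * (q : ℚ) + 1) * (q : ℚ) ^ (6 * t)
        + ((q : ℚ) ^ (6 * t) - 1) / ((q : ℚ) ^ 6 - 1)
        + ∑ i ∈ Finset.Icc 1 t,
            (2 * (q : ℚ) ^ 2 + 2 * (q : ℚ)) * ((q : ℚ) ^ 3 - 1) ^ i * (q : ℚ) ^ (6 * (t - i))
      ≤ (maxCodeSize F (6 + 3 * t) 4 3 : ℚ) := by
  subst hq
  rw [← Nat.card_eq_fintype_card]
  rw [← linkageSize_cast Finite.one_lt_card, Nat.cast_le]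
  obtain ⟨C, -, -, hC, -, -, -, -, -, hcard, -, -⟩ := hasPlaneCode_linkageSize F t
  refine (maxCodeSize_isGreatest F (6 + 3 * t) 4 3).2 ⟨C, hC.isConstantDimensionCode, ?_⟩
  rw [Set.ncard_coe_finset, hcard]
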